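/- Let $G$ be a topological group (not assumed Hausdorff). A Borel measure $\mu$ on a topological space $X$ is called $\tau$-additive if $\mu(\bigcup\mathcal U)=\sup_{U\in\mathcal U}\mu(U)$ for every non-empty upwards directed family $\mathcal U$ of open subsets of $X$; let $\mathcal M_\tau(X)$ denote the set of $\tau$-additive Borel probability measures on $X$. For all $\mu,\nu\in\mathcal M_\tau(G)$ there is a unique $\tau$-additive measure $\mu\times\nu$ on the Borel $\sigma$-algebra of $G\times G$ such that $(\mu\times\nu)(U\times V)=\mu(U)\,\nu(V)$ for all open $U,V\subseteq G$. Define the convolution of $\mu$ and $\nu$ by $$(\mu*\nu)(E)=(\mu\times\nu)\big(\{(g,h)\in G\times G: gh\in E\}\big)\qquad (E\subseteq G\text{ Borel}).$$ Then $\mu*\nu\in\mathcal M_\tau(G)$ for all $\mu,\nu\in\mathcal M_\tau(G)$, and $*$ is associative, so that $(\mathcal M_\tau(G),*)$ is a semigroup. Moreover, if $G$ is a Polish group and $\mathcal M_\tau(G)$ is equipped with the weak topology (the coarsest topology for which $\mu\mapsto\int f\,d\mu$ is continuous for every bounded continuous $f:G\to\mathbb R$), then $(\mathcal M_\tau(G),*)$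 is a Polish semigroup, that is, $\mathcal M_\tau(G)$ is a Polish space and $(\mu,\nu)\mapsto\mu*\nu$ is jointly continuous. -/

import Mathlib

open MeasureTheory Topology

namespace MeasureTheory

/-- A measure on a topological space is `τ`-additive if the measure of the union of every nonempty
upwards directed family of open sets is the supremum of the measures of the members.
(It is used below for measures on the Borel `σ`-algebra only.) -/
def IsTauAdditive {X : Type*} [TopologicalSpace X] {m : MeasurableSpace X} (μ : Measure X) : Prop :=
  ∀ 𝒢 : Set (Set X), 𝒢.Nonempty → DirectedOn (· ⊆ ·) 𝒢 → (∀ U ∈ 𝒢, IsOpen U) →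
    μ (⋃₀ 𝒢) = ⨆ U ∈ 𝒢, μ U

/-- The space `M_τ(X)` of `τ`-additive Borel probability measures on `X`. As a subtype of
`ProbabilityMeasure X` it carries the weak topology, i.e. the coarsest topology for which
`μ ↦ ∫ f dμ` is continuous for all bounded continuous `f`. -/
abbrev TauProbabilityMeasure (X : Type*) [TopologicalSpace X] [MeasurableSpace X] [BorelSpace X] :
    Type _ :=
  {μ : ProbabilityMeasure X // IsTauAdditive (μ : Measure X)}

/-- `P` is a `τ`-additive product of `μ` and `ν`: a `τ`-additive measure on the Borel `σ`-algebra of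
the product space `X × Y` (which may be larger than the product of the two Borel `σ`-algebras)
such that `P (U × V) = μ U * ν V` for all open `U` and `V`. -/
structure IsTauProduct {X Y : Type*} [TopologicalSpace X] [MeasurableSpace X]
    [TopologicalSpace Y] [MeasurableSpace Y] (μ : Measure X) (ν : Measure Y)
    (P : @Measure (X × Y) (borel (X × Y))) : Prop where
  isTauAdditive : IsTauAdditive P
  apply_prod : ∀ (U : Set X) (V : Set Y), IsOpen U → IsOpen V → P (U ×ˢ V) = μ U * ν V

open Classical in
/-- The `τ`-additive product measure on the Borel `σ`-algebra of `X × Y`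
(the zero measure if there is none). -/
noncomputable def tauProd {X Y : Type*} [TopologicalSpace X] [MeasurableSpace X]
    [TopologicalSpace Y] [MeasurableSpace Y] (μ : Measure X) (ν : Measure Y) :
    @Measure (X × Y) (borel (X × Y)) :=
  if h : ∃ P : @Measure (X × Y) (borel (X × Y)), IsTauProduct μ ν P then h.choose else 0

/-- The convolution of two measures on `G`: the push-forward under the multiplication of `G` of
their `τ`-additive product, `E ↦ (μ × ν) {(g, h) | g * h ∈ E}`. -/
noncomputable def tauConv {G : Type*} [Mul G] [TopologicalSpace G] [MeasurableSpace G]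
    (μ ν : Measure G) : Measure G :=
  @Measure.map (G × G) G (borel (G × G)) _ (fun p => p.1 * p.2) (tauProd μ ν)

end MeasureTheory

section

open Set Filter
open scoped ENNReal

/-! The `τ`-additive product is the iterated integral `E ↦ ∫ ν(E_x) dμ(x)`. If `E` is open,
`τ`-additivity of `ν` makes `x ↦ ν(E_x)` lower semicontinuous; a π-system argument then gives
measurability for Borel `E`. Monotone convergence for directed families of lower semicontinuous
functions (`IsTauAdditive.lintegral_iSup_of_directed`) makes the product `τ`-additive. It is unique
because every open set is a directed union of open sets from the σ-algebra generated by open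
rectangles. Integrals against a convolution are thus iterated integrals, and associativity reduces
to that of `G`, with no exchange of integrals.

For Polish `G` every Borel measure is `τ`-additive and the product is the usual one, so joint
continuity follows from continuity of products and push-forwards. For Polishness, embed `G` as a
`Gδ` in the Hilbert cube: probability measures on the cube form a compact metrizable space, and
those concentrated on a `Gδ` form a `Gδ`. -/

theorem Directed.exists_seq_monotone_ge {ι α : Type*} [Preorder α] {f : ι → α}
    (hf : Directed (· ≤ ·) f) (e : ℕ → ι) :
    ∃ t : ℕ → ι, Monotone (f ∘ t) ∧ ∀ n, f (e n) ≤ f (t n) := by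
  choose b hb₁ hb₂ using hf
  let t : ℕ → ι := fun n ↦ Nat.rec (e 0) (fun n i ↦ b i (e (n + 1))) n
  refine ⟨t, monotone_nat_of_le_succ fun n ↦ hb₁ _ _, fun n ↦ ?_⟩
  cases n with
  | zero => exact le_rfl
  | succ n => exact hb₂ _ _

namespace MeasureTheory

/-! ### `τ`-additive measures and directed suprema. -/

section TauAdditive

variable {X Y : Type*} [TopologicalSpace X] [TopologicalSpace Y]

theorem IsTauAdditive.measure_iUnion {m : MeasurableSpace X} {μ : Measure X}
    (hμ : IsTauAdditive μ) {ι : Type*} [Nonempty ι] {U : ι → Set X} (hd : Directed (· ⊆ ·) U)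
    (hU : ∀ i, IsOpen (U i)) : μ (⋃ i, U i) = ⨆ i, μ (U i) := by
  have h := hμ (range U) (range_nonempty U) hd.directedOn_range (by rintro _ ⟨i, rfl⟩; exact hU i)
  rwa [sUnion_range, iSup_range] at h

theorem IsTauAdditive.map [MeasurableSpace X] [OpensMeasurableSpace X] [MeasurableSpace Y]
    [BorelSpace Y] {μ : Measure X} (hμ : IsTauAdditive μ) {f : X → Y} (hf : Continuous f) :
    IsTauAdditive (μ.map f) := by
  intro 𝒢 hne hd ho
  have : Nonempty 𝒢 := hne.to_subtype
  have h : ∀ U ∈ 𝒢, μ.map f U = μ (f ⁻¹' U) := fun U hU ↦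
    Measure.map_apply hf.measurable (ho U hU).measurableSet
  rw [Measure.map_apply hf.measurable (isOpen_sUnion ho).measurableSet, sUnion_eq_iUnion,
    preimage_iUnion, hμ.measure_iUnion, iSup_subtype]
  · exact biSup_congr fun U hU ↦ (h U hU).symm
  · exact fun U V ↦ (directedOn_iff_directed.1 hd U V).imp fun _ h ↦ ⟨preimage_mono h.1, preimage_mono h.2⟩
  · exact fun U ↦ (ho U U.2).preimage hf

/-- On a second countable space every measure is `τ`-additive. -/
theorem isTauAdditive_of_secondCountable [SecondCountableTopology X] [MeasurableSpace X]
    (μ : Measure X) : IsTauAdditive μ := by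
  intro 𝒢 hne hd ho
  refine le_antisymm ?_ (iSup₂_le fun U hU ↦ measure_mono (subset_sUnion_of_mem hU))
  obtain ⟨T, hTc, hTG, hT⟩ := TopologicalSpace.isOpen_sUnion_countable 𝒢 ho
  obtain rfl | hTne := T.eq_empty_or_nonempty
  · simp [← hT]
  obtain ⟨e, rfl⟩ := hTc.exists_eq_range hTne
  obtain ⟨t, ht, het⟩ := (directedOn_iff_directed.1 hd).exists_seq_monotone_ge
    fun n ↦ ⟨e n, hTG (mem_range_self n)⟩
  calc μ (⋃₀ 𝒢) ≤ μ (⋃ n, (t n : Set X)) := by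
        rw [← hT, sUnion_range]; exact measure_mono (iUnion_mono het)
    _ = ⨆ n, μ (t n) := Monotone.measure_iUnion ht
    _ ≤ _ := iSup_le fun n ↦ le_iSup₂_of_le _ (t n).2 le_rfl

/-- Integrals of directed families of lower semicontinuous functions with respect to a
`τ`-additive measure commute with suprema. -/
theorem IsTauAdditive.lintegral_iSup_of_directed [MeasurableSpace X] [OpensMeasurableSpace X]
    {μ : Measure X} [IsFiniteMeasure μ] (hμ : IsTauAdditive μ) {ι : Type*} [Nonempty ι]
    {f : ι → X → ℝ≥0∞} (hf : ∀ i, LowerSemicontinuous (f i)) (hd : Directed (· ≤ ·) f) :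
    ∫⁻ x, ⨆ i, f i x ∂μ = ⨆ i, ∫⁻ x, f i x ∂μ := by
  refine le_antisymm ?_ (iSup_le fun i ↦ lintegral_mono fun x ↦ le_iSup (f · x) i)
  -- Superlevel sets at rational levels are open and directed in `i`, so for each level countably
  -- many indices exhaust the union up to a null set.
  let A : ℚ → ι → Set X := fun q i ↦ f i ⁻¹' Ioi (ENNReal.ofReal q)
  have hA : ∀ q i, IsOpen (A q i) := fun q i ↦ (hf i).isOpen_preimage _
  have key : ∀ q, ∃ s : ℕ → ι, (⋃ n, A q (s n)) =ᵐ[μ] ⋃ i, A q i := by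
    intro q
    obtain ⟨u, -, hu, hmem⟩ := exists_seq_tendsto_sSup (range_nonempty fun i ↦ μ (A q i))
      (OrderTop.bddAbove _)
    choose s hs using hmem
    refine ⟨s, ae_eq_of_subset_of_measure_ge (iUnion_subset fun n ↦ subset_iUnion _ _) ?_
      (MeasurableSet.iUnion fun n ↦ (hA q _).measurableSet).nullMeasurableSet
      (measure_ne_top _ _)⟩
    have hdA : Directed (· ⊆ ·) (A q) := fun i j ↦ (hd i j).imp fun _ h ↦
      ⟨fun x hx ↦ lt_of_lt_of_le hx (h.1 x), fun x hx ↦ lt_of_lt_of_le hx (h.2 x)⟩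
    rw [hμ.measure_iUnion hdA (hA q)]
    refine le_of_tendsto hu (Eventually.of_forall fun n ↦ ?_)
    rw [← hs n]
    exact measure_mono (subset_iUnion (fun n ↦ A q (s n)) n)
  choose s hs using key
  -- A single increasing sequence dominates all the countably many chosen functions, which reduces
  -- the claim to ordinary monotone convergence.
  obtain ⟨e, he⟩ := exists_surjective_nat (ℚ × ℕ)
  obtain ⟨t, ht, het⟩ := hd.exists_seq_monotone_ge fun n ↦ s (e n).1 (e n).2
  have hle : ∀ᵐ x ∂μ, ⨆ i, f i x ≤ ⨆ n, f (t n) x := by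
    filter_upwards [ae_all_iff.2 fun q ↦ (hs q).mem_iff] with x hx
    refine iSup_le fun i ↦ le_of_forall_lt fun c hc ↦ ?_
    obtain ⟨q, -, hcq, hq⟩ := ENNReal.lt_iff_exists_rat_btwn.1 hc
    obtain ⟨n, hn⟩ := mem_iUnion.1 ((hx q).2 (mem_iUnion.2 ⟨i, hq⟩))
    obtain ⟨k, hk⟩ := he (q, n)
    have := het k x
    rw [hk] at this
    exact hcq.trans (lt_of_lt_of_le hn (this.trans (le_iSup (fun n ↦ f (t n) x) k)))
  calc ∫⁻ x, ⨆ i, f i x ∂μ ≤ ∫⁻ x, ⨆ n, f (t n) x ∂μ := lintegral_mono_ae hle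
    _ = ⨆ n, ∫⁻ x, f (t n) x ∂μ := lintegral_iSup (fun n ↦ (hf _).measurable) ht
    _ ≤ _ := iSup_le fun n ↦ le_iSup (fun i ↦ ∫⁻ x, f i x ∂μ) (t n)

end TauAdditive

/-! ### Measures on product spaces and iterated integrals. -/

section Product

/-- Finite `τ`-additive Borel measures on a product are determined by their values on open
rectangles. -/
theorem IsTauAdditive.ext_prod {X Y : Type*} [TopologicalSpace X] [TopologicalSpace Y]
    [m : MeasurableSpace (X × Y)] [BorelSpace (X × Y)] {P Q : Measure (X × Y)} [IsFiniteMeasure P]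
    (hP : IsTauAdditive P) (hQ : IsTauAdditive Q)
    (h : ∀ (U : Set X) (V : Set Y), IsOpen U → IsOpen V → P (U ×ˢ V) = Q (U ×ˢ V)) : P = Q := by
  let C : Set (Set (X × Y)) := {E | ∃ U V, IsOpen U ∧ IsOpen V ∧ U ×ˢ V = E}
  have hC : IsPiSystem C := by
    rintro _ ⟨U, V, hU, hV, rfl⟩ _ ⟨U', V', hU', hV', rfl⟩ -
    exact ⟨U ∩ U', V ∩ V', hU.inter hU', hV.inter hV', prod_inter_prod.symm⟩
  have huniv : P univ = Q univ := by simpa using h univ univ isOpen_univ isOpen_univ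
  have hle : MeasurableSpace.generateFrom C ≤ m := by
    refine MeasurableSpace.generateFrom_le ?_
    rintro _ ⟨U, V, hU, hV, rfl⟩
    exact (hU.prod hV).measurableSet
  have hgen : ∀ F, MeasurableSet[MeasurableSpace.generateFrom C] F → P F = Q F := fun F hF ↦
    ext_on_measurableSpace_of_generate_finite m C
      (by rintro _ ⟨U, V, hU, hV, rfl⟩; exact h U V hU hV) hle rfl hC huniv hF
  refine ext_of_generate_finite _ (BorelSpace.measurable_eq.trans rfl) isPiSystem_isOpen
    (fun E hE ↦ ?_) huniv
  -- `E` itself may lie outside the σ-algebra generated by open rectangles, on which `P` and `Q`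
  -- agree; its open subsets belonging to that σ-algebra are directed and cover it.
  let 𝒢 : Set (Set (X × Y)) :=
    {F | IsOpen F ∧ F ⊆ E ∧ MeasurableSet[MeasurableSpace.generateFrom C] F}
  have hE' : ⋃₀ 𝒢 = E := by
    refine subset_antisymm (sUnion_subset fun F hF ↦ hF.2.1) fun ⟨x, y⟩ hxy ↦ ?_
    obtain ⟨U, V, hU, hV, hx, hy, hUV⟩ := isOpen_prod_iff.1 hE x y hxy
    exact ⟨U ×ˢ V, ⟨hU.prod hV, hUV, MeasurableSpace.measurableSet_generateFrom
      ⟨U, V, hU, hV, rfl⟩⟩, hx, hy⟩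
  have hne : 𝒢.Nonempty := ⟨∅, isOpen_empty, empty_subset _, @MeasurableSet.empty _ (MeasurableSpace.generateFrom C)⟩
  have hd : DirectedOn (· ⊆ ·) 𝒢 := fun F hF F' hF' ↦
    ⟨F ∪ F', ⟨hF.1.union hF'.1, union_subset hF.2.1 hF'.2.1, @MeasurableSet.union _ (MeasurableSpace.generateFrom C) _ _ hF.2.2 hF'.2.2⟩,
      subset_union_left, subset_union_right⟩
  rw [← hE', hP 𝒢 hne hd fun F hF ↦ hF.1, hQ 𝒢 hne hd fun F hF ↦ hF.1]
  exact biSup_congr fun F hF ↦ hgen F hF.2.2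

variable {X Y : Type*} [TopologicalSpace X] [TopologicalSpace Y] [MeasurableSpace Y]

theorem IsTauAdditive.lowerSemicontinuous_measure_prodMk_preimage {ν : Measure Y}
    (hν : IsTauAdditive ν) {E : Set (X × Y)} (hE : IsOpen E) :
    LowerSemicontinuous fun x ↦ ν (Prod.mk x ⁻¹' E) := by
  intro x t ht
  -- Each `V` comes with a neighbourhood `U` of `x` on which the sections still contain `V`.
  -- Directedness takes unions of the `V` and intersections of the `U`.
  let 𝒢 : Set (Set Y) := {V | IsOpen V ∧ ∃ U : Set X, IsOpen U ∧ x ∈ U ∧ U ×ˢ V ⊆ E}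
  have hG : ⋃₀ 𝒢 = Prod.mk x ⁻¹' E := by
    refine subset_antisymm (sUnion_subset fun V ⟨_, U, _, hx, h⟩ y hy ↦ h ⟨hx, hy⟩) fun y hy ↦ ?_
    obtain ⟨U, V, hU, hV, hx, hy, h⟩ := isOpen_prod_iff.1 hE x y hy
    exact ⟨V, ⟨hV, U, hU, hx, h⟩, hy⟩
  have hd : DirectedOn (· ⊆ ·) 𝒢 := by
    rintro V₁ ⟨hV₁, U₁, hU₁, hx₁, h₁⟩ V₂ ⟨hV₂, U₂, hU₂, hx₂, h₂⟩
    refine ⟨V₁ ∪ V₂, ⟨hV₁.union hV₂, U₁ ∩ U₂, hU₁.inter hU₂, ⟨hx₁, hx₂⟩, ?_⟩,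
      subset_union_left, subset_union_right⟩
    rintro ⟨a, b⟩ ⟨⟨ha₁, ha₂⟩, hb | hb⟩
    exacts [h₁ ⟨ha₁, hb⟩, h₂ ⟨ha₂, hb⟩]
  change t < ν (Prod.mk x ⁻¹' E) at ht
  rw [← hG, hν 𝒢 ⟨∅, isOpen_empty, univ, isOpen_univ, mem_univ x, by simp⟩ hd fun V hV ↦ hV.1,
    lt_iSup_iff] at ht
  obtain ⟨V, hV⟩ := ht
  obtain ⟨⟨-, U, hU, hx, h⟩, hV⟩ := lt_iSup_iff.1 hV
  filter_upwards [hU.mem_nhds hx] with x' hx'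
  exact hV.trans_le (measure_mono fun y hy ↦ h ⟨hx', hy⟩)

variable [MeasurableSpace X] [OpensMeasurableSpace X] [BorelSpace Y] [m : MeasurableSpace (X × Y)] [BorelSpace (X × Y)]

theorem IsTauAdditive.measurable_map_prodMk {ν : Measure Y} [IsFiniteMeasure ν]
    (hν : IsTauAdditive ν) : Measurable fun x : X ↦ ν.map (Prod.mk x) := by
  have hmk : ∀ x : X, Measurable (Prod.mk x : Y → X × Y) := fun x ↦
    (Continuous.prodMk_right x).measurable
  have (x : X) : IsFiniteMeasure (ν.map (Prod.mk x)) := inferInstance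
  refine Measurable.measure_of_isPiSystem (BorelSpace.measurable_eq.trans rfl)
    isPiSystem_isOpen (fun E hE ↦ ?_) ?_
  · simp_rw [Measure.map_apply (hmk _) (IsOpen.measurableSet hE)]
    exact (hν.lowerSemicontinuous_measure_prodMk_preimage hE).measurable
  · simp_rw [Measure.map_apply (hmk _) MeasurableSet.univ, preimage_univ]
    exact measurable_const

theorem IsTauAdditive.bind_map_prodMk_apply {μ : Measure X} {ν : Measure Y} [IsFiniteMeasure ν]
    (hν : IsTauAdditive ν) {E : Set (X × Y)} (hE : MeasurableSet E) :
    μ.bind (fun x ↦ ν.map (Prod.mk x)) E = ∫⁻ x, ν (Prod.mk x ⁻¹' E) ∂μ := by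
  rw [Measure.bind_apply hE hν.measurable_map_prodMk.aemeasurable]
  exact lintegral_congr fun x ↦ Measure.map_apply (Continuous.prodMk_right x).measurable hE

theorem IsTauAdditive.bind_map_prodMk {μ : Measure X} {ν : Measure Y} [IsFiniteMeasure μ]
    [IsFiniteMeasure ν] (hμ : IsTauAdditive μ) (hν : IsTauAdditive ν) :
    IsTauAdditive (μ.bind fun x ↦ ν.map (Prod.mk x : Y → X × Y)) := by
  intro 𝒢 hne hd ho
  have : Nonempty 𝒢 := hne.to_subtype
  have hd' := directedOn_iff_directed.1 hd
  calc μ.bind (fun x ↦ ν.map (Prod.mk x)) (⋃₀ 𝒢)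
      = ∫⁻ x, ν (Prod.mk x ⁻¹' ⋃₀ 𝒢) ∂μ :=
        hν.bind_map_prodMk_apply (isOpen_sUnion ho).measurableSet
    _ = ∫⁻ x, ⨆ U : 𝒢, ν (Prod.mk x ⁻¹' U) ∂μ := by
        refine lintegral_congr fun x ↦ ?_
        rw [sUnion_eq_iUnion, preimage_iUnion, hν.measure_iUnion]
        · exact fun U V ↦ (hd' U V).imp fun _ h ↦ ⟨preimage_mono h.1, preimage_mono h.2⟩
        · exact fun U ↦ (ho U U.2).preimage (Continuous.prodMk_right x)
    _ = ⨆ U : 𝒢, ∫⁻ x, ν (Prod.mk x ⁻¹' U) ∂μ :=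
        hμ.lintegral_iSup_of_directed
          (fun U ↦ hν.lowerSemicontinuous_measure_prodMk_preimage (ho U U.2))
          (fun U V ↦ (hd' U V).imp fun _ h ↦
            ⟨fun x ↦ measure_mono (preimage_mono h.1), fun x ↦ measure_mono (preimage_mono h.2)⟩)
    _ = ⨆ U ∈ 𝒢, μ.bind (fun x ↦ ν.map (Prod.mk x)) U := by
        rw [iSup_subtype]
        exact biSup_congr fun U hU ↦ (hν.bind_map_prodMk_apply (ho U hU).measurableSet).symm

end Product

end MeasureTheory

namespace MeasureTheory

/-! ### Existence and uniqueness of the `τ`-additive product. -/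

section TauProd

theorem IsTauProduct.unique {X Y : Type*} [TopologicalSpace X] [MeasurableSpace X]
    [TopologicalSpace Y] [MeasurableSpace Y] {μ : Measure X} {ν : Measure Y} [IsFiniteMeasure μ]
    [IsFiniteMeasure ν] {P Q : @Measure (X × Y) (borel (X × Y))}
    (hP : IsTauProduct μ ν P) (hQ : IsTauProduct μ ν Q) : P = Q := by
  let _ : MeasurableSpace (X × Y) := borel (X × Y)
  have : BorelSpace (X × Y) := ⟨rfl⟩
  have : IsFiniteMeasure P := ⟨by
    rw [← univ_prod_univ, hP.apply_prod _ _ isOpen_univ isOpen_univ]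
    exact ENNReal.mul_lt_top (measure_lt_top _ _) (measure_lt_top _ _)⟩
  exact hP.isTauAdditive.ext_prod hQ.isTauAdditive fun U V hU hV ↦ by
    rw [hP.apply_prod U V hU hV, hQ.apply_prod U V hU hV]

variable {X Y : Type*} [TopologicalSpace X] [MeasurableSpace X] [OpensMeasurableSpace X]
  [TopologicalSpace Y] [MeasurableSpace Y] [BorelSpace Y]
  {μ : Measure X} {ν : Measure Y} [IsFiniteMeasure μ] [IsFiniteMeasure ν]

theorem IsTauAdditive.isTauProduct_bind (hμ : IsTauAdditive μ) (hν : IsTauAdditive ν) :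
    letI : MeasurableSpace (X × Y) := borel (X × Y)
    IsTauProduct μ ν (μ.bind fun x ↦ ν.map (Prod.mk x)) := by
  let _ : MeasurableSpace (X × Y) := borel (X × Y)
  have : BorelSpace (X × Y) := ⟨rfl⟩
  refine ⟨hμ.bind_map_prodMk hν, fun U V hU hV ↦ ?_⟩
  classical
  rw [hν.bind_map_prodMk_apply (hU.prod hV).measurableSet]
  simp_rw [mk_preimage_prod_right_eq_if, apply_ite ν, measure_empty]
  have : (fun x ↦ if x ∈ U then ν V else 0) = U.indicator fun _ ↦ ν V := by
    ext x; simp [indicator_apply]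
  rw [this, lintegral_indicator_const hU.measurableSet, mul_comm]

theorem IsTauAdditive.existsUnique_isTauProduct (hμ : IsTauAdditive μ) (hν : IsTauAdditive ν) :
    ∃! P : @Measure (X × Y) (borel (X × Y)), IsTauProduct μ ν P :=
  ⟨_, hμ.isTauProduct_bind hν, fun _ hP ↦ hP.unique (hμ.isTauProduct_bind hν)⟩

theorem IsTauAdditive.tauProd_eq_bind (hμ : IsTauAdditive μ) (hν : IsTauAdditive ν) :
    letI : MeasurableSpace (X × Y) := borel (X × Y)
    tauProd μ ν = μ.bind fun x ↦ ν.map (Prod.mk x) := by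
  have h := (hμ.existsUnique_isTauProduct hν).exists
  rw [tauProd, dif_pos h]
  exact h.choose_spec.unique (hμ.isTauProduct_bind hν)

end TauProd

/-! ### The convolution semigroup. -/

section TauConv

variable {G : Type*} [TopologicalSpace G] [MeasurableSpace G] [BorelSpace G]

theorem IsTauAdditive.measurable_measure_mul_preimage [Mul G] [ContinuousMul G] {ν : Measure G}
    [IsFiniteMeasure ν] (hν : IsTauAdditive ν) {E : Set G}
    (hE : MeasurableSet E) : Measurable fun x ↦ ν ((x * ·) ⁻¹' E) := by
  let _ : MeasurableSpace (G × G) := borel (G × G)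
  have : BorelSpace (G × G) := ⟨rfl⟩
  have hE' : MeasurableSet ((fun p : G × G ↦ p.1 * p.2) ⁻¹' E) := continuous_mul.measurable hE
  have h := (Measure.measurable_coe hE').comp (hν.measurable_map_prodMk (X := G))
  simp only [Function.comp_def, Measure.map_apply (Continuous.prodMk_right _).measurable hE'] at h
  exact h

section Mul

variable [Mul G] [ContinuousMul G] {μ ν : Measure G} [IsFiniteMeasure μ] [IsFiniteMeasure ν]

theorem IsTauAdditive.tauConv_apply (hμ : IsTauAdditive μ) (hν : IsTauAdditive ν) {E : Set G}
    (hE : MeasurableSet E) : tauConv μ ν E = ∫⁻ x, ν ((x * ·) ⁻¹' E) ∂μ := by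
  let _ : MeasurableSpace (G × G) := borel (G × G)
  have : BorelSpace (G × G) := ⟨rfl⟩
  have hmul : Measurable fun p : G × G ↦ p.1 * p.2 := continuous_mul.measurable
  rw [tauConv, hμ.tauProd_eq_bind hν, Measure.map_apply hmul hE,
    hν.bind_map_prodMk_apply (hmul hE)]
  rfl

theorem IsTauAdditive.lintegral_tauConv (hμ : IsTauAdditive μ) (hν : IsTauAdditive ν)
    {f : G → ℝ≥0∞} (hf : Measurable f) :
    ∫⁻ z, f z ∂tauConv μ ν = ∫⁻ x, ∫⁻ y, f (x * y) ∂ν ∂μ := by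
  let _ : MeasurableSpace (G × G) := borel (G × G)
  have : BorelSpace (G × G) := ⟨rfl⟩
  have hmul : Measurable fun p : G × G ↦ p.1 * p.2 := continuous_mul.measurable
  rw [tauConv, hμ.tauProd_eq_bind hν, lintegral_map hf hmul,
    Measure.lintegral_bind (f := fun p ↦ f (p.1 * p.2)) hν.measurable_map_prodMk.aemeasurable
      (hf.comp hmul).aemeasurable]
  exact lintegral_congr fun x ↦
    lintegral_map (hf.comp hmul) (Continuous.prodMk_right x).measurable

theorem IsTauAdditive.tauConv (hμ : IsTauAdditive μ) (hν : IsTauAdditive ν) :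
    IsTauAdditive (tauConv μ ν) := by
  let _ : MeasurableSpace (G × G) := borel (G × G)
  have : BorelSpace (G × G) := ⟨rfl⟩
  rw [MeasureTheory.tauConv, hμ.tauProd_eq_bind hν]
  exact (hμ.bind_map_prodMk hν).map continuous_mul

theorem IsTauAdditive.isProbabilityMeasure_tauConv {μ ν : Measure G} [IsProbabilityMeasure μ]
    [IsProbabilityMeasure ν] (hμ : IsTauAdditive μ) (hν : IsTauAdditive ν) :
    IsProbabilityMeasure (MeasureTheory.tauConv μ ν) :=
  ⟨by simp [hμ.tauConv_apply hν MeasurableSet.univ]⟩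

/-- Both sides are the same iterated integral; this form gives access to the weak continuity of
ordinary products. -/
theorem IsTauAdditive.tauConv_eq_map_prod [SecondCountableTopology G] (hμ : IsTauAdditive μ)
    (hν : IsTauAdditive ν) :
    MeasureTheory.tauConv μ ν = (μ.prod ν).map fun p ↦ p.1 * p.2 := by
  ext E hE
  have hmul : Measurable fun p : G × G ↦ p.1 * p.2 := continuous_mul.measurable
  rw [hμ.tauConv_apply hν hE, Measure.map_apply hmul hE, Measure.prod_apply (hmul hE)]
  rfl

end Mul

theorem IsTauAdditive.tauConv_assoc [Semigroup G] [ContinuousMul G] {μ ν ρ : Measure G}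
    [IsProbabilityMeasure μ] [IsProbabilityMeasure ν] [IsProbabilityMeasure ρ]
    (hμ : IsTauAdditive μ) (hν : IsTauAdditive ν) (hρ : IsTauAdditive ρ) :
    MeasureTheory.tauConv (MeasureTheory.tauConv μ ν) ρ =
      MeasureTheory.tauConv μ (MeasureTheory.tauConv ν ρ) := by
  have := hμ.isProbabilityMeasure_tauConv hν
  have := hν.isProbabilityMeasure_tauConv hρ
  ext E hE
  rw [(hμ.tauConv hν).tauConv_apply hρ hE, hμ.tauConv_apply (hν.tauConv hρ) hE,
    hμ.lintegral_tauConv hν (hρ.measurable_measure_mul_preimage hE)]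
  refine lintegral_congr fun x ↦ ?_
  rw [hν.tauConv_apply hρ ((continuous_const_mul x).measurable hE)]
  simp only [preimage_preimage, mul_assoc]

namespace TauProbabilityMeasure

/-- The convolution semigroup of `τ`-additive Borel probability measures. -/
noncomputable abbrev convSemigroup [Semigroup G] [ContinuousMul G] :
    Semigroup (TauProbabilityMeasure G) where
  mul μ ν := ⟨⟨tauConv (μ.1 : Measure G) (ν.1 : Measure G),
    μ.2.isProbabilityMeasure_tauConv ν.2⟩, μ.2.tauConv ν.2⟩
  mul_assoc μ ν ρ := Subtype.ext (Subtype.ext (μ.2.tauConv_assoc ν.2 ρ.2))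

theorem continuousMul_convSemigroup [Semigroup G] [ContinuousMul G] [SecondCountableTopology G]
    [TopologicalSpace.PseudoMetrizableSpace G] :
    letI := convSemigroup (G := G)
    ContinuousMul (TauProbabilityMeasure G) := by
  let _ := convSemigroup (G := G)
  refine ⟨Continuous.subtype_mk (f := fun p : TauProbabilityMeasure G × TauProbabilityMeasure G ↦
    (p.1 * p.2).1) ?_ _⟩
  have h : (fun p : TauProbabilityMeasure G × TauProbabilityMeasure G ↦ (p.1 * p.2).1) =
      fun p ↦ (p.1.1.prod p.2.1).map (continuous_mul (M := G)).measurable.aemeasurable := by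
    ext1 p
    exact Subtype.ext (p.1.2.tauConv_eq_map_prod p.2.2)
  rw [h]
  exact (ProbabilityMeasure.continuous_map continuous_mul).comp
    (ProbabilityMeasure.continuous_prod.comp
      (continuous_subtype_val.prodMap continuous_subtype_val))

end TauProbabilityMeasure

end TauConv

end MeasureTheory

/-! ### `Gδ` sets and Polish spaces. -/

/-- A `Gδ` subset of a Polish space is Polish. -/
theorem IsGδ.polishSpace {X : Type*} [TopologicalSpace X] [PolishSpace X] {s : Set X}
    (hs : IsGδ s) : PolishSpace s := by
  obtain ⟨U, hU, rfl⟩ := isGδ_iff_eq_iInter_nat.1 hs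
  have (n : ℕ) : PolishSpace (U n) := (hU n).polishSpace
  -- The diagonal map identifies the intersection with a closed subspace of the product of the
  -- Polish spaces `U n`.
  let F : (⋂ n, U n : Set X) → ∀ n, U n := fun x n ↦ ⟨x, mem_iInter.1 x.2 n⟩
  have hF : Continuous F := continuous_pi fun n ↦ continuous_subtype_val.subtype_mk _
  have hind : IsInducing F := by
    refine .of_comp hF ((continuous_subtype_val.comp (continuous_apply 0)) :
      Continuous fun f : ∀ n, U n ↦ (f 0 : X)) ?_
    exact IsInducing.subtypeVal
  have hrange : range F = ⋂ n, {f | (f n : X) = f 0} := by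
    ext f
    simp only [mem_range, mem_iInter, mem_ofPred_eq]
    constructor
    · rintro ⟨x, rfl⟩ n; rfl
    · exact fun h ↦ ⟨⟨f 0, mem_iInter.2 fun n ↦ h n ▸ (f n).2⟩,
        funext fun n ↦ Subtype.ext (h n).symm⟩
  have hcl : IsClosed (range F) := by
    rw [hrange]
    exact isClosed_iInter fun n ↦ isClosed_eq (continuous_subtype_val.comp (continuous_apply n))
      (continuous_subtype_val.comp (continuous_apply 0))
  exact IsClosedEmbedding.polishSpace (f := F)
    ⟨⟨hind, fun x y h ↦ Subtype.ext (congrArg (fun f : ∀ n, U n ↦ (f 0 : X)) h)⟩, hcl⟩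

/-- The range of an embedding of a complete metric space into a metrizable space is a `Gδ` set. -/
theorem Topology.IsEmbedding.isGδ_range {X K : Type*} [MetricSpace X] [CompleteSpace X]
    [TopologicalSpace K] [TopologicalSpace.MetrizableSpace K] {e : X → K} (he : IsEmbedding e) :
    IsGδ (range e) := by
  -- `U n` is where the inverse of `e` oscillates by less than `1 / (n + 1)`. At a point of the
  -- closure lying in every `U n`, the pulled-back neighbourhood filter is Cauchy, and its limit
  -- maps to that point.
  let U : ℕ → Set K := fun n ↦
    ⋃₀ {W | IsOpen W ∧ ∀ x y, e x ∈ W → e y ∈ W → dist x y < 1 / (n + 1)}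
  have hU : ∀ n, IsOpen (U n) := fun n ↦ isOpen_sUnion fun W hW ↦ hW.1
  have h : range e = closure (range e) ∩ ⋂ n, U n := by
    refine subset_antisymm (subset_inter subset_closure ?_) ?_
    · rintro _ ⟨x, rfl⟩
      refine mem_iInter.2 fun n ↦ ?_
      have hn : (0 : ℝ) < 1 / (n + 1) := Nat.one_div_pos_of_nat
      obtain ⟨W, hW, hWx⟩ := he.isInducing.isOpen_iff.1
        (Metric.isOpen_ball (x := x) (ε := 1 / (n + 1) / 2))
      refine ⟨W, ⟨hW, fun y z hy hz ↦ ?_⟩, ?_⟩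
      · have hy' : y ∈ e ⁻¹' W := hy
        have hz' : z ∈ e ⁻¹' W := hz
        rw [hWx, Metric.mem_ball] at hy' hz'
        linarith [dist_triangle_right y z x]
      · change x ∈ e ⁻¹' W
        rw [hWx]
        exact Metric.mem_ball_self (half_pos hn)
    · rintro k ⟨hk, hkU⟩
      have hne : (comap e (𝓝 k)).NeBot := comap_neBot_iff_frequently.2 (mem_closure_iff_frequently.1 hk)
      have hc : Cauchy (comap e (𝓝 k)) := by
        refine Metric.cauchy_iff.2 ⟨hne, fun ε hε ↦ ?_⟩
        obtain ⟨n, hn⟩ := exists_nat_one_div_lt hε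
        obtain ⟨W, ⟨hW, hd⟩, hkW⟩ := mem_iInter.1 hkU n
        exact ⟨e ⁻¹' W, preimage_mem_comap (hW.mem_nhds hkW),
          fun x hx y hy ↦ (hd x y hx hy).trans hn⟩
      obtain ⟨x, hx⟩ := CompleteSpace.complete hc
      refine ⟨x, tendsto_nhds_unique (f := e) (l := comap e (𝓝 k)) ?_ tendsto_comap⟩
      exact (he.continuous.tendsto x).mono_left hx
  rw [h]
  let _ := TopologicalSpace.metrizableSpaceMetric K
  exact isClosed_closure.isGδ.inter (.iInter_of_isOpen hU)

theorem TopologicalSpace.exists_isEmbedding_isGδ_range (X : Type*) [TopologicalSpace X]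
    [PolishSpace X] : ∃ e : X → ℕ → unitInterval, IsEmbedding e ∧ IsGδ (range e) := by
  let _ := upgradeIsCompletelyMetrizable X
  obtain ⟨e, he⟩ := Metric.PiNatEmbed.exists_embedding_to_hilbert_cube (X := X)
  exact ⟨e, he, he.isGδ_range⟩

/-! ### The weak topology on probability measures. -/

namespace MeasureTheory.ProbabilityMeasure

section Embedding

variable {X K : Type*} [TopologicalSpace X] [MeasurableSpace X] [BorelSpace X]
  [TopologicalSpace K] [MeasurableSpace K] [BorelSpace K]

/-- The mass of an open set is a lower semicontinuous function of the measure. -/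
theorem lowerSemicontinuous_measure_isOpen [HasOuterApproxClosed K] {U : Set K} (hU : IsOpen U) :
    LowerSemicontinuous fun μ : ProbabilityMeasure K ↦ (μ : Measure K) U :=
  lowerSemicontinuous_iff_le_liminf.2 fun _ ↦ le_liminf_measure_open_of_tendsto tendsto_id hU

/-- Full mass on `⋂ n, U n` means mass above `1 - 1 / (k + 1)` on `U n` for all `n` and `k`; each
such condition is open by lower semicontinuity. -/
theorem isGδ_setOf_measure_eq_one [HasOuterApproxClosed K] {s : Set K} (hs : IsGδ s) :
    IsGδ {μ : ProbabilityMeasure K | (μ : Measure K) s = 1} := by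
  obtain ⟨U, hU, rfl⟩ := isGδ_iff_eq_iInter_nat.1 hs
  have h : {μ : ProbabilityMeasure K | (μ : Measure K) (⋂ n, U n) = 1} =
      ⋂ n, ⋂ k : ℕ, {μ : ProbabilityMeasure K | 1 - ((k : ℝ≥0∞) + 1)⁻¹ < (μ : Measure K) (U n)} := by
    ext μ
    have hU' : ∀ n, MeasurableSet (U n) := fun n ↦ (hU n).measurableSet
    simp only [mem_iInter, mem_ofPred_eq, ← prob_compl_eq_zero_iff (MeasurableSet.iInter hU'),
      compl_iInter, measure_iUnion_null_iff, prob_compl_eq_zero_iff (hU' _)]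
    refine forall_congr' fun n ↦ ⟨fun h k ↦ ?_, fun h ↦ le_antisymm prob_le_one ?_⟩
    · rw [h]
      exact ENNReal.sub_lt_self ENNReal.one_ne_top one_ne_zero (by simp)
    · refine ENNReal.le_of_forall_pos_le_add fun ε hε _ ↦ ?_
      obtain ⟨k, hk⟩ := ENNReal.exists_inv_nat_lt (ENNReal.coe_pos.2 hε).ne'
      refine tsub_le_iff_right.1 ((tsub_le_tsub_left ?_ 1).trans (h k).le)
      exact (ENNReal.inv_le_inv.2 le_self_add).trans hk.le
  rw [h]
  exact .iInter fun n ↦ .iInter_of_isOpen fun k ↦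
    (lowerSemicontinuous_measure_isOpen (hU n)).isOpen_preimage _

theorem isInducing_map [TopologicalSpace.PseudoMetrizableSpace X]
    [TopologicalSpace.SeparableSpace X] [TopologicalSpace.PseudoMetrizableSpace K]
    [TopologicalSpace.SeparableSpace K] {e : X → K} (he : IsInducing e) :
    IsInducing fun μ : ProbabilityMeasure X ↦ μ.map he.continuous.measurable.aemeasurable := by
  refine isInducing_iff_nhds.2 fun μ ↦ le_antisymm
    ((continuous_map he.continuous).tendsto μ).le_comap ?_
  -- By the portmanteau theorem convergence is tested on open sets, and each open set of `X` is the
  -- preimage of one in `K`.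
  refine tendsto_id'.1 (tendsto_of_forall_isOpen_le_liminf' fun U hU ↦ ?_)
  obtain ⟨V, hV, rfl⟩ := he.isOpen_iff.1 hU
  have h := le_liminf_measure_open_of_tendsto (tendsto_comap
    (x := 𝓝 (μ.map he.continuous.measurable.aemeasurable)) (f := fun μ : ProbabilityMeasure X ↦ μ.map he.continuous.measurable.aemeasurable)) hV
  simpa [Measure.map_apply he.continuous.measurable hV.measurableSet] using h

end Embedding

/-- The space of Borel probability measures on a Polish space, with the weak topology, is
Polish. -/
instance instPolishSpace (X : Type*) [TopologicalSpace X] [PolishSpace X] [MeasurableSpace X]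
    [BorelSpace X] : PolishSpace (ProbabilityMeasure X) := by
  obtain ⟨e, he, hG⟩ := TopologicalSpace.exists_isEmbedding_isGδ_range X
  have hem : Measurable e := he.continuous.measurable
  have : PolishSpace (ProbabilityMeasure (ℕ → unitInterval)) := by
    let _ := TopologicalSpace.metrizableSpaceMetric (ProbabilityMeasure (ℕ → unitInterval))
    infer_instance
  let S := {μ : ProbabilityMeasure (ℕ → unitInterval) |
    (μ : Measure (ℕ → unitInterval)) (range e) = 1}
  have : PolishSpace S := (isGδ_setOf_measure_eq_one hG).polishSpace
  have hme : MeasurableEmbedding e :=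
    he.measurableEmbedding hG.measurableSet
  have hS (μ : ProbabilityMeasure X) : μ.map hem.aemeasurable ∈ S := by
    simp [S, Measure.map_apply hem hG.measurableSet]
  let F : ProbabilityMeasure X → S := fun μ ↦ ⟨μ.map hem.aemeasurable, hS μ⟩
  have hF : IsInducing F := (isInducing_map he.isInducing).codRestrict hS
  -- A measure concentrated on the range of `e` is the push-forward of its pull-back.
  have hsurj : Function.Surjective F := fun ν ↦ by
    have hν : (ν.1 : Measure _) (range e) = 1 := ν.2
    refine ⟨⟨(ν.1 : Measure _).comap e, ⟨?_⟩⟩, Subtype.ext (Subtype.ext ?_)⟩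
    · rw [hme.comap_apply, image_univ, hν]
    · refine (hme.map_comap _).trans (Measure.restrict_eq_self_of_ae_mem ?_)
      exact (prob_compl_eq_zero_iff hG.measurableSet).2 hν
  exact IsClosedEmbedding.polishSpace (f := F)
    ⟨hF.isEmbedding, hsurj.range_eq ▸ isClosed_univ⟩

end MeasureTheory.ProbabilityMeasure

/-- On a Polish space the space of `τ`-additive Borel probability measures is Polish. -/
theorem MeasureTheory.TauProbabilityMeasure.polishSpace (X : Type*) [TopologicalSpace X]
    [PolishSpace X] [MeasurableSpace X] [BorelSpace X] : PolishSpace (TauProbabilityMeasure X) :=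
  IsClosed.polishSpace (s := {μ : ProbabilityMeasure X | IsTauAdditive (μ : Measure X)}) (by
    simp [isTauAdditive_of_secondCountable])

end

/-- For a topological group `G`, the `τ`-additive product of any two members of `M_τ(G)` exists and
is unique, and convolution is a semigroup operation on `M_τ(G)`; if `G` is Polish, then `M_τ(G)`
with the weak topology is a Polish space on which convolution is jointly continuous. -/
theorem mainTheorem8 (G : Type*) [Group G] [TopologicalSpace G] [IsTopologicalGroup G]
    [MeasurableSpace G] [BorelSpace G] :
    (∀ μ ν : TauProbabilityMeasure G,
      ∃! P : @Measure (G × G) (borel (G × G)),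
        IsTauProduct (μ.1 : Measure G) (ν.1 : Measure G) P) ∧
    ∃ _ : Semigroup (TauProbabilityMeasure G),
      (∀ μ ν : TauProbabilityMeasure G,
        ((μ * ν).1 : Measure G) = tauConv (μ.1 : Measure G) (ν.1 : Measure G)) ∧
      (PolishSpace G →
        PolishSpace (TauProbabilityMeasure G) ∧ ContinuousMul (TauProbabilityMeasure G)) := by
  refine ⟨fun μ ν ↦ μ.2.existsUnique_isTauProduct ν.2, TauProbabilityMeasure.convSemigroup,
    fun μ ν ↦ rfl, fun _ ↦ ⟨TauProbabilityMeasure.polishSpace G, ?_⟩⟩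
  exact TauProbabilityMeasure.continuousMul_convSemigroup
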